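/- Let $K=\mathbb{F}_q$ be a finite field, $n\ge 1$, and let $v_1,\dots,v_n$ be positive integers. Let $\beta$ be a generator of the cyclic group $K^*$, let $d_i$ be the order of $\beta^{v_i}$, and let $S=K[t_1,\dots,t_n]$ with the standard grading. Let $$X=\{[(x_1^{v_1},\dots,x_n^{v_n})] : x_i\in K^* \text{ for all } i\}\subset\mathbb{P}^{n-1}$$ be the degenerate projective torus over $K$, let $I(X)\subset S$ be its vanishing ideal (the ideal generated by the homogeneous polynomials that vanish on $X$), and let $P\subset S$ be the toric ideal of $K[y^{d_1},\dots,y^{d_n}]\subset K[y]$, i.e. the kernel of the $K$-algebra homomorphism $S\to K[y]$, $t_i\mapsto y^{d_i}$. A binomial is a polynomial of the form $t^a-t^b$ with $a,b\in\mathbb{N}^n$. An ideal of $S$ is a complete intersection if it can be generated by $m$ elements, where $m$ is its height. (a) If $I(X)$ is a complete intersection generated by binomials $h_1,\dots,h_{n-1}$, then $P$ is a complete intersection generated by binomials $g_1,\dots,g_{n-1}$ such that $h_i=g_i(t_1^{d_1},\dots,t_n^{d_n})$ for all $i$. (b) If $P$ is a complete intersection generated by binomials $g_1,\dots,g_{n-1}$,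 then $I(X)$ is a complete intersection generated by binomials $h_1,\dots,h_{n-1}$, where $h_i=g_i(t_1^{d_1},\dots,t_n^{d_n})$ for all $i$. -/

import Mathlib

open scoped LinearAlgebra.Projectivization

/-- A binomial: a polynomial of the form `t^a - t^b`. -/
def IsBinomial {K : Type*} [Field K] {n : ℕ} (f : MvPolynomial (Fin n) K) : Prop :=
  ∃ a b : Fin n →₀ ℕ, f = MvPolynomial.monomial a 1 - MvPolynomial.monomial b 1

/-- An ideal is a complete intersection if it can be generated by `m` elements,
where `m` is its height. -/
def IsCompleteIntersection {R : Type*} [CommRing R] (I : Ideal R) : Prop :=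
  ∃ (m : ℕ) (g : Fin m → R), I = Ideal.span (Set.range g) ∧ I.height = (m : ℕ∞)

/-- The degenerate projective torus
`{[(x₁^{v₁}, …, xₙ^{vₙ})] | xᵢ ∈ K^*} ⊆ ℙ^{n-1}`. -/
def degenerateTorus (K : Type*) [Field K] {n : ℕ} (v : Fin n → ℕ) :
    Set (ℙ K (Fin n → K)) :=
  {p | ∃ (x : Fin n → Kˣ) (hx : (fun i => (x i : K) ^ v i) ≠ 0),
    p = Projectivization.mk K (fun i => (x i : K) ^ v i) hx}

/-- The vanishing ideal of a set `Y` of points of projective space: the ideal generated by the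
homogeneous polynomials that vanish at every point of `Y` (that is, at every vector of homogeneous
coordinates of every point of `Y`). -/
noncomputable def projVanishingIdeal {K : Type*} [Field K] {n : ℕ} (Y : Set (ℙ K (Fin n → K))) :
    Ideal (MvPolynomial (Fin n) K) :=
  Ideal.span {f | (∃ e : ℕ, f.IsHomogeneous e) ∧
    ∀ (w : Fin n → K) (hw : w ≠ 0), Projectivization.mk K w hw ∈ Y → MvPolynomial.eval w f = 0}

/-- The toric ideal of `K[y^{d₁}, …, y^{dₙ}] ⊆ K[y]`: the kernel of the `K`-algebra map
`K[t₁, …, tₙ] → K[y]`, `tᵢ ↦ y^{dᵢ}`, whose image is `K[y^{d₁}, …, y^{dₙ}]`. -/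
noncomputable def monomialCurveIdeal (K : Type*) [Field K] {n : ℕ} (d : Fin n → ℕ) :
    Ideal (MvPolynomial (Fin n) K) :=
  RingHom.ker (MvPolynomial.aeval (R := K) (fun i => (Polynomial.X : Polynomial K) ^ d i))

/-- The substitution `g ↦ g(t₁^{d₁}, …, tₙ^{dₙ})`. -/
noncomputable def substPow {K : Type*} [Field K] {n : ℕ} (d : Fin n → ℕ)
    (g : MvPolynomial (Fin n) K) : MvPolynomial (Fin n) K :=
  MvPolynomial.aeval (fun i => (MvPolynomial.X i : MvPolynomial (Fin n) K) ^ d i) g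

/-!
Write `φ` for the substitution `tᵢ ↦ tᵢ^{dᵢ}` of `S = K[t₁, …, tₙ]`. Everything rests on the
identity `I(X) = φ(P) S` (`projVanishingIdeal_eq_map`). The value of `t^a` at `(xᵢ^{vᵢ})` is a
character of `(K^*)ⁿ` that determines `a` modulo `(d₁, …, dₙ)`. Independence of characters therefore
writes a homogeneous polynomial vanishing on `X` as a combination of binomials `t^a - t^b` with
`|a| = |b|` and `a ≡ b` modulo `d`. Such a binomial equals `t^r φ(g)`, where `r` is the common
remainder and `g` is a binomial of equal `d`-weights, hence a member of `P`. Conversely `P` is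
spanned by binomials of equal weights, and `φ` takes them to homogeneous binomials that vanish on
`X`.

Generators of `P` thus map to generators of `I(X)`. In the other direction `φ` has a `φ(S)`-linear
retraction (`contractPow_mul_substPowHom`), so `g₁, …, gₘ ∈ P` generate `P` as soon as their images
generate `I(X)`.

Both heights are `n - 1`. The bound `≤` is Krull's height theorem. For `P` the bound `≥` comes from
an explicit chain of primes (`le_height_monomialCurveIdeal`), and it passes to `I(X)` by going down,
since `φ` is an integral extension of a normal domain.

For (a) it remains to see that each `hᵢ` is in the image of `φ`, that is, `r = 0` in
`hᵢ = t^r φ(g)`. Otherwise `φ(g)` lies in `I(X)` and has smaller degree than `hᵢ`, so it is a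
combination of the other `hⱼ` and `hᵢ` is redundant (`span_image_ne_eq_of_monomial_mul`); then
`n - 2` elements generate an ideal of height `n - 1`, against Krull's theorem.
-/

open MvPolynomial

/-! ### Sums over fibres of the exponents -/

/-- If the coefficients of `f` sum to zero over every fibre of a map `Φ` on exponents, then `f` is
a combination of binomials `t^a - t^b` with `Φ a = Φ b`. -/
theorem mem_of_sum_coeff_fiber_eq_zero {K σ ι : Type*} [Field K] (J : Ideal (MvPolynomial σ K))
    (Φ : (σ →₀ ℕ) → ι) (f : MvPolynomial σ K)
    (hJ : ∀ a ∈ f.support, ∀ b ∈ f.support, Φ a = Φ b →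
      (monomial a 1 - monomial b 1 : MvPolynomial σ K) ∈ J)
    (hsum : ∀ i, ∑ᶠ a ∈ {a | a ∈ f.support ∧ Φ a = i}, coeff a f = 0) : f ∈ J := by
  classical
  rw [f.as_sum, ← Finset.sum_fiberwise_of_maps_to
    (fun a ha => Finset.mem_image_of_mem Φ ha)]
  refine J.sum_mem fun i hi => ?_
  obtain ⟨b, hb, rfl⟩ := Finset.mem_image.1 hi
  have h0 : ∑ a ∈ f.support with Φ a = Φ b, coeff a f = 0 := by
    rw [← hsum (Φ b), ← finsum_mem_coe_finset]
    simp
  have : ∑ a ∈ f.support with Φ a = Φ b, monomial a (coeff a f)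
      = ∑ a ∈ f.support with Φ a = Φ b, C (coeff a f) * (monomial a 1 - monomial b 1) := by
    simp only [mul_sub, Finset.sum_sub_distrib, C_mul_monomial, mul_one]
    rw [← map_sum, h0, map_zero, sub_zero]
  rw [this]
  refine J.sum_mem fun a ha => J.mul_mem_left _ ?_
  rw [Finset.mem_filter] at ha
  exact hJ a ha.1 b hb ha.2

/-! ### The substitution of powers -/

section Subst

variable {K : Type*} [Field K] {n : ℕ} (d : Fin n → ℕ)

/-- The substitution `g ↦ g(t₁^{d₁}, …, tₙ^{dₙ})` as an algebra homomorphism. -/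
noncomputable def substPowHom : MvPolynomial (Fin n) K →ₐ[K] MvPolynomial (Fin n) K :=
  aeval (fun i => (X i : MvPolynomial (Fin n) K) ^ d i)

theorem substPow_eq (g : MvPolynomial (Fin n) K) : substPow d g = substPowHom d g := rfl

/-- The exponent `(d₁ a₁, …, dₙ aₙ)`. -/
noncomputable def mulExp (a : Fin n →₀ ℕ) : Fin n →₀ ℕ :=
  Finsupp.equivFunOnFinite.symm fun i => d i * a i

/-- The exponent `(⌊a₁ / d₁⌋, …, ⌊aₙ / dₙ⌋)`. -/
noncomputable def divExp (a : Fin n →₀ ℕ) : Fin n →₀ ℕ :=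
  Finsupp.equivFunOnFinite.symm fun i => a i / d i

/-- The exponent of remainders `(a₁ mod d₁, …, aₙ mod dₙ)`. -/
noncomputable def modExp (a : Fin n →₀ ℕ) : Fin n →₀ ℕ :=
  Finsupp.equivFunOnFinite.symm fun i => a i % d i

@[simp] theorem mulExp_apply (a : Fin n →₀ ℕ) (i : Fin n) : mulExp d a i = d i * a i := rfl

@[simp] theorem divExp_apply (a : Fin n →₀ ℕ) (i : Fin n) : divExp d a i = a i / d i := rfl

@[simp] theorem modExp_apply (a : Fin n →₀ ℕ) (i : Fin n) : modExp d a i = a i % d i := rfl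

theorem modExp_add_mulExp_divExp (a : Fin n →₀ ℕ) : modExp d a + mulExp d (divExp d a) = a := by
  ext i
  simp [Nat.mod_add_div]

theorem degree_mulExp (a : Fin n →₀ ℕ) : (mulExp d a).degree = ∑ i, d i * a i := by
  simp [Finsupp.degree_eq_sum]

@[simp] theorem substPowHom_monomial (a : Fin n →₀ ℕ) (c : K) :
    substPowHom d (monomial a c) = monomial (mulExp d a) c := by
  rw [substPowHom, aeval_monomial, monomial_eq, Finsupp.prod_fintype _ _ (by simp),
    Finsupp.prod_fintype _ _ (by simp)]
  simp [pow_mul, algebraMap_eq]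

/-- The linear map which sends `t^a` to `t^{a/d}` if every `dᵢ` divides `aᵢ`, and to `0`
otherwise; it is linear over the image of the substitution `tᵢ ↦ tᵢ^{dᵢ}`. -/
noncomputable def contractPow : MvPolynomial (Fin n) K →ₗ[K] MvPolynomial (Fin n) K :=
  open Classical in
  (basisMonomials (Fin n) K).constr K fun a =>
    if ∀ i, d i ∣ a i then monomial (divExp d a) 1 else 0

open Classical in
theorem contractPow_monomial (a : Fin n →₀ ℕ) (c : K) :
    contractPow d (monomial a c) = if ∀ i, d i ∣ a i then monomial (divExp d a) c else 0 := by
  have h : (monomial a c : MvPolynomial (Fin n) K) = c • basisMonomials (Fin n) K a := by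
    simp [smul_monomial]
  rw [h, map_smul, contractPow, Module.Basis.constr_basis]
  split_ifs <;> simp [smul_monomial]

variable {d}

theorem contractPow_mul_substPowHom (hd : ∀ i, 0 < d i) (c g : MvPolynomial (Fin n) K) :
    contractPow d (c * substPowHom d g) = contractPow d c * g := by
  classical
  induction c using MvPolynomial.induction_on' with
  | add p q hp hq => rw [add_mul, map_add, hp, hq, map_add, add_mul]
  | monomial a r =>
    induction g using MvPolynomial.induction_on' with
    | add p q hp hq => rw [map_add, mul_add, map_add, hp, hq, mul_add]
    | monomial b s =>
      rw [substPowHom_monomial, monomial_mul, contractPow_monomial, contractPow_monomial]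
      have h1 : (∀ i, d i ∣ (a + mulExp d b) i) ↔ ∀ i, d i ∣ a i := by
        refine forall_congr' fun i => ?_
        rw [Finsupp.add_apply, mulExp_apply, Nat.dvd_add_left (dvd_mul_right _ _)]
      have h2 : divExp d (a + mulExp d b) = divExp d a + b := by
        ext i
        simp [Nat.add_mul_div_left _ _ (hd i)]
      rw [if_congr h1 rfl rfl, h2]
      split_ifs <;> simp [monomial_mul]

theorem contractPow_substPowHom (hd : ∀ i, 0 < d i) (g : MvPolynomial (Fin n) K) :
    contractPow d (substPowHom d g) = g := by
  classical
  have h : contractPow d (1 : MvPolynomial (Fin n) K) = 1 := by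
    have := contractPow_monomial d 0 (1 : K)
    have h0 : divExp d 0 = 0 := by ext i; simp
    simpa [h0] using this
  simpa [h] using contractPow_mul_substPowHom hd 1 g

theorem substPowHom_injective (hd : ∀ i, 0 < d i) :
    Function.Injective (substPowHom d : MvPolynomial (Fin n) K →ₐ[K] _) :=
  Function.LeftInverse.injective (contractPow_substPowHom hd)

/-- Ideals are contracted from their extensions along the substitution of powers. -/
theorem mem_of_substPowHom_mem_map (hd : ∀ i, 0 < d i) {I : Ideal (MvPolynomial (Fin n) K)}
    {f : MvPolynomial (Fin n) K} (hf : substPowHom d f ∈ I.map (substPowHom d)) : f ∈ I := by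
  rw [← contractPow_substPowHom hd f]
  refine Submodule.span_induction (p := fun x _ => ∀ c, contractPow d (c * x) ∈ I)
    ?_ ?_ ?_ ?_ hf 1 |> fun h => by simpa using h
  · rintro _ ⟨g, hg, rfl⟩ c
    exact (contractPow_mul_substPowHom hd c g).symm ▸ I.mul_mem_left _ hg
  · simp
  · intro x y _ _ hx hy c
    rw [mul_add, map_add]
    exact I.add_mem (hx c) (hy c)
  · intro a x _ hx c
    rw [smul_eq_mul, ← mul_assoc]
    exact hx _

theorem substPowHom_isIntegral (hd : ∀ i, 0 < d i) :
    (substPowHom d : MvPolynomial (Fin n) K →ₐ[K] _).toRingHom.IsIntegral := by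
  intro p
  induction p using MvPolynomial.induction_on with
  | C a =>
    have h : (C a : MvPolynomial (Fin n) K) = (substPowHom d).toRingHom (C a) :=
      ((substPowHom d).commutes a).symm
    rw [h]
    exact RingHom.isIntegralElem_map _
  | add p q hp hq => exact hp.add _ hq
  | mul_X p i hp =>
    refine hp.mul _ ?_
    refine ⟨Polynomial.X ^ d i - Polynomial.C (X i), Polynomial.monic_X_pow_sub_C _ (hd i).ne', ?_⟩
    simp [substPowHom]

end Subst

/-! ### Heights -/

/-- By going down, heights do not increase under contraction along an integral extension of a
normal domain. -/
theorem height_comap_le_of_isIntegral {R S : Type*} [CommRing R] [CommRing S] [IsDomain S]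
    [IsIntegrallyClosed R] [IsNoetherianRing R] [IsNoetherianRing S] (f : R →+* S)
    (hinj : Function.Injective f) (hf : f.IsIntegral) (Q : Ideal S) [Q.IsPrime] :
    (Q.comap f).height ≤ Q.height := by
  let := f.toAlgebra
  have : FaithfulSMul R S := (faithfulSMul_iff_algebraMap_injective R S).2 hinj
  have : Algebra.IsIntegral R S := ⟨hf⟩
  have : Q.LiesOver (Q.comap f) := ⟨rfl⟩
  rw [Ideal.height_eq_height_add_of_liesOver_of_hasGoingDown (Q.comap f) Q]
  exact le_self_add

theorem height_le_height_map_of_isIntegral {R S : Type*} [CommRing R] [CommRing S] [IsDomain S]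
    [IsIntegrallyClosed R] [IsNoetherianRing R] [IsNoetherianRing S] (f : R →+* S)
    (hinj : Function.Injective f) (hf : f.IsIntegral) (I : Ideal R) :
    I.height ≤ (I.map f).height := by
  rw [(I.map f).height_eq_inf_minimalPrimes]
  refine le_iInf₂ fun Q hQ => ?_
  have := hQ.1.1
  exact (Ideal.height_mono (Ideal.map_le_iff_le_comap.1 hQ.1.2)).trans
    (height_comap_le_of_isIntegral f hinj hf Q)

theorem height_span_le_ncard {R : Type*} [CommRing R] [IsNoetherianRing R] {s : Set R}
    (hs : s.Finite) (h : Ideal.span s ≠ ⊤) : (Ideal.span s).height ≤ s.ncard :=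
  (Ideal.height_le_spanFinrank _ h).trans
    (by exact_mod_cast Submodule.spanFinrank_span_le_ncard_of_finite hs)

theorem height_span_range_le {R : Type*} [CommRing R] [IsNoetherianRing R] {m : ℕ} (g : Fin m → R)
    (h : Ideal.span (Set.range g) ≠ ⊤) : (Ideal.span (Set.range g)).height ≤ m := by
  refine (height_span_le_ncard (Set.finite_range g) h).trans ?_
  rw [← Set.image_univ]
  exact_mod_cast (Set.ncard_image_le Set.finite_univ).trans (by simp [Set.ncard_univ])

section Curve

variable {K : Type*} [Field K] {n : ℕ}

/-- The endomorphism of `K[t₀, …, tₙ]` which sends `tᵢ` to `t₀^{dᵢ}` for `i ≤ k` and fixes the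
other variables. The kernels for `k = 0, …, n` form a chain of primes inside the toric ideal. -/
noncomputable def partialCurveHom (K : Type*) [Field K] (d : Fin (n + 1) → ℕ) (k : ℕ) :
    MvPolynomial (Fin (n + 1)) K →ₐ[K] MvPolynomial (Fin (n + 1)) K :=
  aeval fun i => if (i : ℕ) ≤ k then X 0 ^ d i else X i

theorem ker_partialCurveHom_lt_succ (d : Fin (n + 1) → ℕ) (hd : ∀ i, 0 < d i) {k : ℕ}
    (hk : k < n) :
    RingHom.ker (partialCurveHom K d k) < RingHom.ker (partialCurveHom K d (k + 1)) := by
  set j : Fin (n + 1) := ⟨k + 1, by omega⟩ with hj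
  have hj0 : j ≠ 0 := by simp [hj, Fin.ext_iff]
  refine SetLike.lt_iff_le_and_exists.2 ⟨?_, X j ^ d 0 - X 0 ^ d j, ?_, ?_⟩
  · have hcomp : partialCurveHom K d (k + 1) =
        (aeval fun i => if i = j then X 0 ^ d j else X i).comp (partialCurveHom K d k) := by
      refine MvPolynomial.algHom_ext fun i => ?_
      rcases lt_trichotomy (i : ℕ) (k + 1) with h | h | h
      · simp [partialCurveHom, Nat.lt_succ_iff.1 h, h.le, hj0.symm]
      · obtain rfl : i = j := Fin.ext h
        simp [partialCurveHom, h]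
      · have h' : i ≠ j := fun e => by simp [e, hj] at h
        simp [partialCurveHom, h', show ¬ (i : ℕ) ≤ k by omega, show ¬ (i : ℕ) ≤ k + 1 by omega]
    intro f hf
    rw [RingHom.mem_ker] at hf ⊢
    rw [hcomp, AlgHom.comp_apply, hf, map_zero]
  · rw [RingHom.mem_ker]
    simp [partialCurveHom, hj, ← pow_mul, mul_comm]
  -- The image of `tⱼ^{d₀} - t₀^{dⱼ}` under the `k`-th map does not vanish at the `j`-th unit vector.
  · rw [RingHom.mem_ker]
    intro h
    have := congrArg (eval fun i => if i = j then (1 : K) else 0) h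
    simp [partialCurveHom, hj, (hd _).ne'] at this

theorem le_height_monomialCurveIdeal (d : Fin (n + 1) → ℕ) (hd : ∀ i, 0 < d i) :
    (n : ℕ∞) ≤ (monomialCurveIdeal K d).height := by
  have key : ∀ k : ℕ, k ≤ n → (k : ℕ∞) ≤ (RingHom.ker (partialCurveHom K d k)).height := by
    intro k
    induction k with
    | zero => simp
    | succ k ih =>
      intro hk
      have := RingHom.ker_isPrime (partialCurveHom K d k)
      have := RingHom.ker_isPrime (partialCurveHom K d (k + 1))
      push_cast
      exact (add_le_add_left (ih (by omega)) 1).trans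
        (Ideal.height_add_one_le_of_lt_of_isPrime (ker_partialCurveHom_lt_succ d hd (by omega)))
  refine (key n le_rfl).trans (Ideal.height_mono fun f hf => ?_)
  have hcomp : aeval (R := K) (fun i => (Polynomial.X : Polynomial K) ^ d i) =
      (aeval fun _ => Polynomial.X).comp (partialCurveHom K d n) := by
    refine MvPolynomial.algHom_ext fun i => ?_
    simp [partialCurveHom, Nat.lt_succ_iff.1 i.2]
  rw [RingHom.mem_ker] at hf
  rw [monomialCurveIdeal, RingHom.mem_ker, hcomp, AlgHom.comp_apply, hf, map_zero]

theorem monomialCurveIdeal_ne_top (d : Fin n → ℕ) : monomialCurveIdeal K d ≠ ⊤ :=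
  RingHom.ker_ne_top _

theorem binomial_mem_monomialCurveIdeal {d : Fin n → ℕ} {a b : Fin n →₀ ℕ}
    (h : ∑ i, d i * a i = ∑ i, d i * b i) :
    (monomial a 1 - monomial b 1 : MvPolynomial (Fin n) K) ∈ monomialCurveIdeal K d := by
  rw [monomialCurveIdeal, RingHom.mem_ker, map_sub, aeval_monomial, aeval_monomial,
    Finsupp.prod_fintype _ _ (by simp), Finsupp.prod_fintype _ _ (by simp)]
  simp [← pow_mul, Finset.prod_pow_eq_pow_sum, h]

/-- The coefficients of a member of the toric ideal sum to zero over each weight. -/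
theorem sum_coeff_weight_eq_zero {d : Fin n → ℕ} {f : MvPolynomial (Fin n) K}
    (hf : f ∈ monomialCurveIdeal K d) (w : ℕ) :
    ∑ᶠ a ∈ {a | a ∈ f.support ∧ ∑ i, d i * a i = w}, coeff a f = 0 := by
  classical
  rw [monomialCurveIdeal, RingHom.mem_ker, aeval_def, eval₂_eq'] at hf
  have h := congrArg (fun p => Polynomial.coeff p w) hf
  simp only [← pow_mul, Finset.prod_pow_eq_pow_sum, Polynomial.finsetSum_coeff,
    Polynomial.algebraMap_eq, Polynomial.coeff_C_mul, Polynomial.coeff_X_pow, mul_ite, mul_one,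
    mul_zero, Polynomial.coeff_zero] at h
  rw [← Finset.sum_filter] at h
  rw [← h, ← finsum_mem_coe_finset]
  simp [eq_comm]

end Curve

/-! ### The vanishing ideal of the torus -/

section Torus

variable {K : Type*} [Field K] {n : ℕ}

/-- The character `x ↦ ∏ xᵢ^{vᵢ aᵢ}` of `(K^*)ⁿ`, the value of `t^a` at `(xᵢ^{vᵢ})`. -/
noncomputable def torusChar (K : Type*) [Field K] (v : Fin n → ℕ) (a : Fin n →₀ ℕ) :
    (Fin n → Kˣ) →* K where
  toFun x := ∏ i, ((x i : K) ^ v i) ^ a i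
  map_one' := by simp
  map_mul' x y := by simp [mul_pow, Finset.prod_mul_distrib]

theorem eval_monomial_eq_torusChar (v : Fin n → ℕ) (a : Fin n →₀ ℕ) (c : K) (x : Fin n → Kˣ) :
    eval (fun i => (x i : K) ^ v i) (monomial a c) = c * torusChar K v a x := by
  rw [eval_monomial, Finsupp.prod_fintype _ _ (by simp)]
  rfl

theorem modExp_eq_of_torusChar_eq {v : Fin n → ℕ} {β : Kˣ} {d : Fin n → ℕ}
    (hd : ∀ i, d i = orderOf (β ^ v i)) {a b : Fin n →₀ ℕ}
    (h : torusChar K v a = torusChar K v b) : modExp d a = modExp d b := by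
  classical
  ext i
  have h1 := DFunLike.congr_fun h (Pi.mulSingle i β)
  have h2 : ∀ c : Fin n →₀ ℕ, torusChar K v c (Pi.mulSingle i β) = (((β ^ v i) ^ c i : Kˣ) : K) := by
    intro c
    change ∏ j, (((Pi.mulSingle i β : Fin n → Kˣ) j : K) ^ v j) ^ c j = _
    rw [Finset.prod_eq_single i]
    · simp
    · intro j _ hj
      simp [Pi.mulSingle_eq_of_ne hj]
    · simp
  rw [h2, h2] at h1
  rw [modExp_apply, modExp_apply, hd i]
  exact pow_eq_pow_iff_modEq.1 (Units.ext h1)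

/-- By independence of characters, the coefficients of a polynomial vanishing on the torus sum
to zero over each set of exponents that define the same character. -/
theorem sum_coeff_torusChar_eq_zero {v : Fin n → ℕ} {f : MvPolynomial (Fin n) K}
    (hf : ∀ x : Fin n → Kˣ, eval (fun i => (x i : K) ^ v i) f = 0) (χ : (Fin n → Kˣ) →* K) :
    ∑ᶠ a ∈ {a | a ∈ f.support ∧ torusChar K v a = χ}, coeff a f = 0 := by
  classical
  have hli := linearIndependent_iff'.1 (linearIndependent_monoidHom (Fin n → Kˣ) K)
    (f.support.image (torusChar K v))
    (fun χ => ∑ a ∈ f.support with torusChar K v a = χ, coeff a f) (by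
      ext x
      have h := hf x
      rw [f.as_sum, map_sum, ← Finset.sum_fiberwise_of_maps_to
        (fun a ha => Finset.mem_image_of_mem (torusChar K v) ha)] at h
      rw [Finset.sum_apply, Pi.zero_apply, ← h]
      refine Finset.sum_congr rfl fun χ _ => ?_
      rw [Pi.smul_apply, smul_eq_mul, Finset.sum_mul]
      refine Finset.sum_congr rfl fun a ha => ?_
      rw [eval_monomial_eq_torusChar, (Finset.mem_filter.1 ha).2])
  have h2 : ∑ᶠ a ∈ {a | a ∈ f.support ∧ torusChar K v a = χ}, coeff a f
      = ∑ a ∈ f.support with torusChar K v a = χ, coeff a f := by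
    rw [← finsum_mem_coe_finset]
    simp
  rw [h2]
  by_cases hχ : χ ∈ f.support.image (torusChar K v)
  · exact hli χ hχ
  · refine Finset.sum_eq_zero fun a ha => absurd ?_ hχ
    rw [Finset.mem_filter] at ha
    exact Finset.mem_image.2 ⟨a, ha⟩

theorem torusPoint_ne_zero (hn : 0 < n) (v : Fin n → ℕ) (x : Fin n → Kˣ) :
    (fun i => (x i : K) ^ v i) ≠ 0 := fun h => by
  have := congrFun h ⟨0, hn⟩
  simp at this

theorem eval_eq_zero_of_mem_projVanishingIdeal (hn : 0 < n) {v : Fin n → ℕ}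
    {f : MvPolynomial (Fin n) K} (hf : f ∈ projVanishingIdeal (degenerateTorus K v))
    (x : Fin n → Kˣ) : eval (fun i => (x i : K) ^ v i) f = 0 := by
  have h : projVanishingIdeal (degenerateTorus K v) ≤
      RingHom.ker (eval fun i => (x i : K) ^ v i) :=
    Ideal.span_le.2 fun g hg =>
      hg.2 _ (torusPoint_ne_zero hn v x) ⟨x, torusPoint_ne_zero hn v x, rfl⟩
  exact h hf

theorem projVanishingIdeal_ne_top (hn : 0 < n) (v : Fin n → ℕ) :
    projVanishingIdeal (degenerateTorus K v) ≠ ⊤ := fun h => by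
  have := eval_eq_zero_of_mem_projVanishingIdeal (f := 1) hn (h ▸ Submodule.mem_top) 1
  simp at this

attribute [local instance] MvPolynomial.gradedAlgebra

theorem projVanishingIdeal_isHomogeneous (Y : Set (ℙ K (Fin n → K))) :
    (projVanishingIdeal Y).IsHomogeneous (homogeneousSubmodule (Fin n) K) :=
  Ideal.homogeneous_span _ _ fun _ hf => ⟨hf.1.choose, hf.1.choose_spec⟩

/-- A nontrivial binomial of the vanishing ideal is homogeneous: its homogeneous components also
vanish on the torus, and a monomial does not. -/
theorem degree_eq_of_binomial_mem (hn : 0 < n) {v : Fin n → ℕ} {a b : Fin n →₀ ℕ}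
    (h : (monomial a 1 - monomial b 1 : MvPolynomial (Fin n) K) ∈
      projVanishingIdeal (degenerateTorus K v)) : a.degree = b.degree := by
  by_contra hab
  have h1 := homogeneousComponent_mem_of_mem (projVanishingIdeal_isHomogeneous _) h a.degree
  rw [map_sub, homogeneousComponent_of_mem (isHomogeneous_monomial 1 rfl),
    homogeneousComponent_of_mem (isHomogeneous_monomial 1 rfl), if_pos rfl, if_neg hab,
    sub_zero] at h1
  have h2 := eval_eq_zero_of_mem_projVanishingIdeal hn h1 1
  simp [eval_monomial] at h2

theorem torusChar_eq_of_binomial_mem (hn : 0 < n) {v : Fin n → ℕ} {a b : Fin n →₀ ℕ}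
    (h : (monomial a 1 - monomial b 1 : MvPolynomial (Fin n) K) ∈
      projVanishingIdeal (degenerateTorus K v)) : torusChar K v a = torusChar K v b := by
  refine DFunLike.ext _ _ fun x => ?_
  have := eval_eq_zero_of_mem_projVanishingIdeal hn h x
  simpa [eval_monomial_eq_torusChar, sub_eq_zero] using this

/-- A binomial whose exponents agree modulo `d` is the product of the monomial of the common
remainder and a substituted binomial. -/
theorem binomial_eq_mul_substPowHom (d : Fin n → ℕ) {a b : Fin n →₀ ℕ}
    (h : modExp d a = modExp d b) :
    (monomial a 1 - monomial b 1 : MvPolynomial (Fin n) K) = monomial (modExp d a) 1 *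
      substPowHom d (monomial (divExp d a) 1 - monomial (divExp d b) 1) := by
  rw [map_sub, substPowHom_monomial, substPowHom_monomial, mul_sub, monomial_mul, monomial_mul,
    modExp_add_mulExp_divExp, h, modExp_add_mulExp_divExp, mul_one]

theorem sum_mul_divExp_eq (d : Fin n → ℕ) {a b : Fin n →₀ ℕ} (h : modExp d a = modExp d b)
    (hdeg : a.degree = b.degree) : ∑ i, d i * divExp d a i = ∑ i, d i * divExp d b i := by
  rw [← degree_mulExp, ← degree_mulExp]
  have h1 := congrArg Finsupp.degree (modExp_add_mulExp_divExp d a)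
  have h2 := congrArg Finsupp.degree (modExp_add_mulExp_divExp d b)
  rw [map_add] at h1 h2
  rw [h] at h1
  omega

/-- The vanishing ideal of the degenerate torus is the extension of the toric ideal along the
substitution `tᵢ ↦ tᵢ^{dᵢ}`. -/
theorem projVanishingIdeal_eq_map (hn : 0 < n) {v : Fin n → ℕ} {β : Kˣ}
    (hβ : ∀ x : Kˣ, x ∈ Subgroup.zpowers β) {d : Fin n → ℕ}
    (hd : ∀ i, d i = orderOf (β ^ v i)) :
    projVanishingIdeal (degenerateTorus K v) = (monomialCurveIdeal K d).map (substPowHom d) := by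
  apply le_antisymm
  · refine Ideal.span_le.2 fun f hf => ?_
    obtain ⟨⟨e, he⟩, hf⟩ := hf
    refine mem_of_sum_coeff_fiber_eq_zero _ (torusChar K v) f (fun a ha b hb hab => ?_)
      (sum_coeff_torusChar_eq_zero fun x =>
        hf _ (torusPoint_ne_zero hn v x) ⟨x, torusPoint_ne_zero hn v x, rfl⟩)
    have hm := modExp_eq_of_torusChar_eq hd hab
    rw [binomial_eq_mul_substPowHom d hm]
    refine Ideal.mul_mem_left _ _ (Ideal.mem_map_of_mem _ (binomial_mem_monomialCurveIdeal
      (sum_mul_divExp_eq d hm ?_)))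
    exact (he.degree_eq_sum_deg_support ha).symm.trans (he.degree_eq_sum_deg_support hb)
  · refine Ideal.map_le_iff_le_comap.2 fun f hf => ?_
    refine mem_of_sum_coeff_fiber_eq_zero _ (fun a => ∑ i, d i * a i) f (fun a _ b _ hab => ?_)
      (sum_coeff_weight_eq_zero hf)
    rw [Ideal.mem_comap, map_sub, substPowHom_monomial, substPowHom_monomial]
    refine Ideal.subset_span ⟨⟨∑ i, d i * a i, (isHomogeneous_monomial 1 (degree_mulExp d a)).sub
      (isHomogeneous_monomial 1 ((degree_mulExp d b).trans hab.symm))⟩, ?_⟩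
    rintro w hw ⟨x, hx, hwx⟩
    obtain ⟨l, hl⟩ := (Projectivization.mk_eq_mk_iff _ _ _ hw hx).1 hwx
    have hpow : ∀ i, ((x i : K) ^ v i) ^ d i = 1 := by
      intro i
      obtain ⟨z, hz⟩ := Subgroup.mem_zpowers_iff.1 (hβ (x i))
      have : ((x i) ^ v i) ^ d i = 1 := by
        rw [← hz, hd i, ← zpow_natCast (β ^ z), ← zpow_mul, mul_comm, zpow_mul, zpow_natCast,
          ← zpow_natCast, ← zpow_mul, mul_comm, zpow_mul, zpow_natCast, pow_orderOf_eq_one,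
          one_zpow]
      simpa using congrArg Units.val this
    have hw' : ∀ i, w i ^ d i = (l : K) ^ d i := by
      intro i
      rw [← hl, Pi.smul_apply, Units.smul_def, smul_eq_mul, mul_pow, hpow, mul_one]
    have hev : ∀ c : Fin n →₀ ℕ, eval w (monomial (mulExp d c) 1) = (l : K) ^ ∑ i, d i * c i := by
      intro c
      rw [eval_monomial, Finsupp.prod_fintype _ _ (by simp), one_mul, ← Finset.prod_pow_eq_pow_sum]
      exact Finset.prod_congr rfl fun i _ => by rw [mulExp_apply, pow_mul, hw', pow_mul]
    rw [map_sub, hev, hev, hab, sub_self]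

/-- Graded Nakayama for one generator: if `h i = m * p` with `m` a monomial of positive degree and
`p` in the ideal generated by the homogeneous family `h`, then `h i` is redundant. -/
theorem span_image_ne_eq_of_monomial_mul {ι : Type*} {h : ι → MvPolynomial (Fin n) K}
    {e : ι → ℕ} (hh : ∀ j, (h j).IsHomogeneous (e j)) {i : ι} {r : Fin n →₀ ℕ} (hr : r ≠ 0)
    {p : MvPolynomial (Fin n) K} {k : ℕ} (hp : p.IsHomogeneous k) (hp0 : h i ≠ 0)
    (hi : h i = monomial r 1 * p) (hmem : p ∈ Ideal.span (Set.range h)) :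
    Ideal.span (h '' {j | j ≠ i}) = Ideal.span (Set.range h) := by
  classical
  set J := Ideal.span (h '' {j | j ≠ i}) with hJ
  have hJh : J.IsHomogeneous (homogeneousSubmodule (Fin n) K) :=
    Ideal.homogeneous_span _ _ (by rintro _ ⟨j, _, rfl⟩; exact ⟨e j, hh j⟩)
  have hle : k < e i := by
    have h1 : (h i).IsHomogeneous (r.degree + k) := by
      rw [hi]; exact (isHomogeneous_monomial 1 rfl).mul hp
    rw [(hh i).inj_right h1 hp0]
    have : r.degree ≠ 0 := mt (Finsupp.degree_eq_zero_iff r).1 hr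
    omega
  have hpJ : p ∈ J := by
    have hins : Set.range h = insert (h i) (h '' {j | j ≠ i}) := by
      rw [← Set.image_insert_eq, ← Set.image_univ]
      congr 1
      ext j
      simp [em]
    rw [hins, Ideal.mem_span_insert] at hmem
    obtain ⟨c, z, hz, hpz⟩ := hmem
    have h1 := homogeneousComponent_mem_of_mem hJh hz k
    have h2 : homogeneousComponent k (c * h i) = 0 := by
      ext a
      rw [coeff_homogeneousComponent, coeff_zero]
      split_ifs with ha
      · rw [coeff_mul]
        refine Finset.sum_eq_zero fun x hx => ?_
        rw [Finset.HasAntidiagonal.mem_antidiagonal] at hx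
        rw [(hh i).coeff_eq_zero, mul_zero]
        rw [← hx, map_add] at ha
        omega
      · rfl
    have h3 : homogeneousComponent k p = homogeneousComponent k z := by
      rw [hpz, map_add, h2, zero_add]
    rw [homogeneousComponent_eq_self hp] at h3
    exact h3 ▸ h1
  refine le_antisymm (Ideal.span_mono (Set.image_subset_range _ _)) (Ideal.span_le.2 ?_)
  rintro _ ⟨j, rfl⟩
  by_cases hj : j = i
  · subst hj
    rw [hi]
    exact J.mul_mem_left _ hpJ
  · exact Ideal.subset_span ⟨j, hj, rfl⟩

end Torus

/-! ### Descent of binomial generators -/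

/-- If the vanishing ideal has height at least `n - 1`, then each of `n - 1` binomials that generate it is
the substitution of a binomial of the toric ideal. -/
theorem exists_binomial_of_generators {K : Type*} [Field K] {n : ℕ} (hn : 0 < n)
    {v : Fin n → ℕ} {β : Kˣ} (hβ : ∀ x : Kˣ, x ∈ Subgroup.zpowers β)
    {d : Fin n → ℕ} (hd : ∀ i, d i = orderOf (β ^ v i))
    (hht : ((n - 1 : ℕ) : ℕ∞) ≤ (projVanishingIdeal (degenerateTorus K v)).height)
    {h : Fin (n - 1) → MvPolynomial (Fin n) K} (hb : ∀ i, IsBinomial (h i))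
    (hspan : projVanishingIdeal (degenerateTorus K v) = Ideal.span (Set.range h))
    (i : Fin (n - 1)) :
    ∃ g, IsBinomial g ∧ g ∈ monomialCurveIdeal K d ∧ h i = substPow d g := by
  have hmem : ∀ j, h j ∈ projVanishingIdeal (degenerateTorus K v) := fun j =>
    hspan ▸ Ideal.subset_span ⟨j, rfl⟩
  choose a b hab using hb
  have hdeg : ∀ j, (a j).degree = (b j).degree := fun j =>
    degree_eq_of_binomial_mem hn (hab j ▸ hmem j)
  have hmod := modExp_eq_of_torusChar_eq hd (torusChar_eq_of_binomial_mem hn (hab i ▸ hmem i))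
  have hfac := binomial_eq_mul_substPowHom (K := K) d hmod
  have hg := binomial_mem_monomialCurveIdeal (K := K) (sum_mul_divExp_eq d hmod (hdeg i))
  by_cases h0 : h i = 0
  · refine ⟨0, ⟨0, 0, by simp⟩, Ideal.zero_mem _, ?_⟩
    rw [h0, substPow_eq, map_zero]
  by_cases hr : modExp d (a i) = 0
  · refine ⟨_, ⟨_, _, rfl⟩, hg, ?_⟩
    rw [hr] at hfac
    rw [hab i, hfac, substPow_eq]
    simp
  -- A nontrivial common factor makes `h i` redundant, against Krull's height theorem.
  · exfalso
    have hred := span_image_ne_eq_of_monomial_mul (h := h) (e := fun j => (a j).degree)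
      (fun j => by
        rw [hab j]
        exact (isHomogeneous_monomial 1 rfl).sub (isHomogeneous_monomial 1 (hdeg j).symm))
      (i := i) hr (p := substPowHom d (monomial (divExp d (a i)) 1 - monomial (divExp d (b i)) 1))
      (k := ∑ l, d l * divExp d (a i) l) (by
        rw [map_sub, substPowHom_monomial, substPowHom_monomial]
        exact (isHomogeneous_monomial 1 (degree_mulExp d _)).sub (isHomogeneous_monomial 1
          ((degree_mulExp d _).trans (sum_mul_divExp_eq d hmod (hdeg i)).symm)))
      h0 ((hab i).trans hfac)
      (by rw [← hspan, projVanishingIdeal_eq_map hn hβ hd]; exact Ideal.mem_map_of_mem _ hg)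
    rw [← hspan] at hred
    have hK := height_span_le_ncard (s := h '' {j | j ≠ i}) (Set.toFinite _)
      (hred ▸ projVanishingIdeal_ne_top hn v)
    rw [hred] at hK
    have h1 : n - 1 ≤ (h '' {j | j ≠ i}).ncard := by exact_mod_cast hht.trans hK
    have h2 : (h '' {j | j ≠ i}).ncard ≤ ({j | j ≠ i} : Set (Fin (n - 1))).ncard :=
      Set.ncard_image_le (Set.toFinite _)
    have h3 : ({j | j ≠ i} : Set (Fin (n - 1))).ncard < n - 1 := by
      have := Set.ncard_lt_ncard (s := {j | j ≠ i}) (t := Set.univ)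
        (Set.ssubset_univ_iff.2 fun h => by
          have : i ∈ {j | j ≠ i} := h ▸ Set.mem_univ i
          exact this rfl)
      simpa [Set.ncard_univ] using this
    omega

theorem theorem3p5 {K : Type*} [Field K] [Finite K] {n : ℕ} (hn : 0 < n)
    (v : Fin n → ℕ) (hv : ∀ i, 0 < v i)
    (β : Kˣ) (hβ : ∀ x : Kˣ, x ∈ Subgroup.zpowers β)
    (d : Fin n → ℕ) (hd : ∀ i, d i = orderOf (β ^ v i)) :
    (∀ h : Fin (n - 1) → MvPolynomial (Fin n) K, (∀ i, IsBinomial (h i)) →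
      IsCompleteIntersection (projVanishingIdeal (degenerateTorus K v)) →
      projVanishingIdeal (degenerateTorus K v) = Ideal.span (Set.range h) →
      IsCompleteIntersection (monomialCurveIdeal K d) ∧
      ∃ g : Fin (n - 1) → MvPolynomial (Fin n) K, (∀ i, IsBinomial (g i)) ∧
        monomialCurveIdeal K d = Ideal.span (Set.range g) ∧
        ∀ i, h i = substPow d (g i)) ∧
    (∀ g : Fin (n - 1) → MvPolynomial (Fin n) K, (∀ i, IsBinomial (g i)) →
      IsCompleteIntersection (monomialCurveIdeal K d) →
      monomialCurveIdeal K d = Ideal.span (Set.range g) →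
      IsCompleteIntersection (projVanishingIdeal (degenerateTorus K v)) ∧
      ∃ h : Fin (n - 1) → MvPolynomial (Fin n) K, (∀ i, IsBinomial (h i)) ∧
        projVanishingIdeal (degenerateTorus K v) = Ideal.span (Set.range h) ∧
        ∀ i, h i = substPow d (g i)) := by
  have hdpos : ∀ i, 0 < d i := fun i => hd i ▸ orderOf_pos _
  have hIP := projVanishingIdeal_eq_map hn hβ hd
  have hP : ((n - 1 : ℕ) : ℕ∞) ≤ (monomialCurveIdeal K d).height := by
    obtain ⟨m, rfl⟩ := Nat.exists_eq_succ_of_ne_zero hn.ne'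
    exact le_height_monomialCurveIdeal d hdpos
  have hI : ((n - 1 : ℕ) : ℕ∞) ≤ (projVanishingIdeal (degenerateTorus K v)).height := by
    rw [hIP]
    exact hP.trans (height_le_height_map_of_isIntegral (substPowHom d).toRingHom
      (substPowHom_injective hdpos) (substPowHom_isIntegral hdpos) _)
  refine ⟨fun h hb _ hspan => ?_, fun g hb _ hspan => ?_⟩
  · choose g hgb hgP hgh using exists_binomial_of_generators hn hβ hd hI hb hspan
    have hPg : monomialCurveIdeal K d = Ideal.span (Set.range g) := by
      refine le_antisymm (fun f hf => mem_of_substPowHom_mem_map hdpos ?_)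
        (Ideal.span_le.2 (by rintro _ ⟨i, rfl⟩; exact hgP i))
      have h1 : substPowHom d f ∈ Ideal.span (Set.range h) := by
        rw [← hspan, hIP]
        exact Ideal.mem_map_of_mem _ hf
      rw [Ideal.map_span, ← Set.range_comp]
      exact (funext hgh : h = substPowHom d ∘ g) ▸ h1
    exact ⟨⟨n - 1, g, hPg, le_antisymm
      (hPg ▸ height_span_range_le g (hPg ▸ monomialCurveIdeal_ne_top d)) hP⟩, g, hgb, hPg, hgh⟩
  · have hIh : projVanishingIdeal (degenerateTorus K v) =
        Ideal.span (Set.range fun i => substPow d (g i)) := by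
      rw [hIP, hspan, Ideal.map_span, ← Set.range_comp]
      rfl
    refine ⟨⟨n - 1, _, hIh, le_antisymm
      (hIh ▸ height_span_range_le _ (hIh ▸ projVanishingIdeal_ne_top hn v)) hI⟩,
      fun i => substPow d (g i), fun i => ?_, hIh, fun _ => rfl⟩
    obtain ⟨a, b, hab⟩ := hb i
    exact ⟨mulExp d a, mulExp d b, by simp [hab, substPow_eq]⟩
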